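/- Let $n\ge 2$ and $\alpha,\beta\in\mathbb{C}$. Consider the system $$u'=-u^2+2uv+\alpha(uv-vu),\qquad v'=-v^2+2vu+\beta(vu-uv) \qquad (*)$$ for $u,v\in \mathrm{Mat}_n(\mathbb{C})$ and its formal Laurent solutions $$u=\frac{p}{z-z_0}+x_0+x_1(z-z_0)+\cdots,\qquad v=\frac{q}{z-z_0}+y_0+y_1(z-z_0)+\cdots,$$ where $z_0\in\mathbb{C}$ and $p,q,x_j,y_j\in \mathrm{Mat}_n(\mathbb{C})$. Such a solution is said to contain $N$ arbitrary constants if it is a family of formal solutions parametrized by a non-empty open subset of $\mathbb{C}^N$ such that $z_0$ and all the entries of $p,q,x_j,y_j$ ($j\ge 0$) are holomorphic functions of the parameters, and at every point no non-zero tangent vector of the parameter space is annihilated by the differentials of all these functions. It is called maximal if it contains $2n^2$ arbitrary constants. A maximal solution is of type 1, 2 or 3 if for all values of the parameters the residues $p,q$ are simultaneously conjugate (by a matrix in $GL_n(\mathbb{C})$ that may depend on the parameters) to, respectively, 1. $p=\mathrm{diag}(-1,0,\dots,0)$, $q=\mathrm{diag}(-1,0,\dots,0)$; 2. $p=\mathrm{diag}(1,0,\dots,0)$,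 $q=0$; 3. $p=0$, $q=\mathrm{diag}(1,0,\dots,0)$. Then: (i) a maximal solution of type 1 of $(*)$ exists if and only if $\alpha+\beta$ is an integer with $-3\le\alpha+\beta\le-1$; (ii) a maximal solution of type 2 of $(*)$ exists if and only if $\beta$ is an integer with $-2\le\beta\le 0$; (iii) a maximal solution of type 3 of $(*)$ exists if and only if $\alpha$ is an integer with $-2\le\alpha\le 0$. -/

import Mathlib

noncomputable section

namespace MatrixP4

/-- Formal Laurent series in `t = z - z₀` with coefficients in `Mat_n(ℂ)`. -/
abbrev MatLaurent (n : ℕ) : Type := LaurentSeries (Matrix (Fin n) (Fin n) ℂ)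

/-- `(u, v)` is a formal solution
`u = p t⁻¹ + x₀ + x₁ t + ⋯`, `v = q t⁻¹ + y₀ + y₁ t + ⋯`, with `t = z - z₀`, of the system
`u' = -u² + 2uv + α(uv - vu)`, `v' = -v² + 2vu + β(vu - uv)`.
The system is autonomous, so the equations for the coefficients do not involve `z₀`. -/
structure IsFormalSolution {n : ℕ} (α β : ℂ) (u v : MatLaurent n) : Prop where
  pole_u : ∀ k : ℤ, k < -1 → u.coeff k = 0
  pole_v : ∀ k : ℤ, k < -1 → v.coeff k = 0
  eq_u : LaurentSeries.derivative ℂ u = -(u * u) + (2 : ℂ) • (u * v) + α • (u * v - v * u)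
  eq_v : LaurentSeries.derivative ℂ v = -(v * v) + (2 : ℂ) • (v * u) + β • (v * u - u * v)

/-- `diag(-I_{k₁}, I_{k₂}, 0_{k₃}, 0, …)`. -/
def resP (n k₁ k₂ : ℕ) : Matrix (Fin n) (Fin n) ℂ :=
  Matrix.diagonal fun i =>
    if (i : ℕ) < k₁ then -1 else if (i : ℕ) < k₁ + k₂ then 1 else 0

/-- `diag(-I_{k₁}, 0_{k₂}, I_{k₃}, 0, …)`. -/
def resQ (n k₁ k₂ k₃ : ℕ) : Matrix (Fin n) (Fin n) ℂ :=
  Matrix.diagonal fun i =>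
    if (i : ℕ) < k₁ then -1 else if (i : ℕ) < k₁ + k₂ then 0
    else if (i : ℕ) < k₁ + k₂ + k₃ then 1 else 0

/-- `p` and `q` are simultaneously conjugate to `diag(-I_{k₁}, I_{k₂}, 0_{k₃}, 0_{k₄})` and
`diag(-I_{k₁}, 0_{k₂}, I_{k₃}, 0_{k₄})`, where `k₁ + k₂ + k₃ + k₄ = n`. -/
def HasResidueType {n : ℕ} (k₁ k₂ k₃ k₄ : ℕ) (p q : Matrix (Fin n) (Fin n) ℂ) : Prop :=
  k₁ + k₂ + k₃ + k₄ = n ∧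
    ∃ S : GL (Fin n) ℂ,
      p = (S : Matrix (Fin n) (Fin n) ℂ) * resP n k₁ k₂ *
        ((S⁻¹ : GL (Fin n) ℂ) : Matrix (Fin n) (Fin n) ℂ) ∧
      q = (S : Matrix (Fin n) (Fin n) ℂ) * resQ n k₁ k₂ k₃ *
        ((S⁻¹ : GL (Fin n) ℂ) : Matrix (Fin n) (Fin n) ℂ)

/-- A formal solution that contains `N` arbitrary constants: a family `(z₀, u, v)`, where `u`, `v`
are series in `z - z₀`, of formal solutions parametrized by a non-empty open subset `U` of `ℂ^N`.
The pole `z₀` and all entries of all coefficients depend holomorphically on the parameters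
`w ∈ U`, and the parameters are independent: no non-zero direction `ξ` in the parameter space
annihilates the differentials of `z₀` and of all the coefficients. -/
structure IsSolutionFamily {n : ℕ} (α β : ℂ) (N : ℕ) (U : Set (Fin N → ℂ))
    (z₀ : (Fin N → ℂ) → ℂ) (u v : (Fin N → ℂ) → MatLaurent n) : Prop where
  isOpen : IsOpen U
  nonempty : U.Nonempty
  isFormalSolution : ∀ w ∈ U, IsFormalSolution α β (u w) (v w)
  differentiableOn_pole : DifferentiableOn ℂ z₀ U
  differentiableOn_u : ∀ (k : ℤ) (i j : Fin n),
    DifferentiableOn ℂ (fun w => (u w).coeff k i j) U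
  differentiableOn_v : ∀ (k : ℤ) (i j : Fin n),
    DifferentiableOn ℂ (fun w => (v w).coeff k i j) U
  independent : ∀ w ∈ U, ∀ ξ : Fin N → ℂ,
    fderiv ℂ z₀ w ξ = 0 →
    (∀ (k : ℤ) (i j : Fin n), fderiv ℂ (fun w' => (u w').coeff k i j) w ξ = 0) →
    (∀ (k : ℤ) (i j : Fin n), fderiv ℂ (fun w' => (v w').coeff k i j) w ξ = 0) →
    ξ = 0

/-- There is a maximal solution (one with `2n²` arbitrary constants, the position `z₀` of the pole
and the parameters in the residues being counted) whose residues `p`, `q` are diagonalizable with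
the block sizes `k₁, k₂, k₃, k₄`. -/
def ExistsMaximalSolution (n : ℕ) (α β : ℂ) (k₁ k₂ k₃ k₄ : ℕ) : Prop :=
  ∃ (U : Set (Fin (2 * n ^ 2) → ℂ)) (z₀ : (Fin (2 * n ^ 2) → ℂ) → ℂ)
    (u v : (Fin (2 * n ^ 2) → ℂ) → MatLaurent n),
    IsSolutionFamily α β (2 * n ^ 2) U z₀ u v ∧
    ∀ w ∈ U, HasResidueType k₁ k₂ k₃ k₄ ((u w).coeff (-1)) ((v w).coeff (-1))

/-- Type 1: residues conjugate to `p = diag(-1, 0, …, 0)`, `q = diag(-1, 0, …, 0)`. -/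
def ExistsMaximalType1 (n : ℕ) (α β : ℂ) : Prop :=
  ExistsMaximalSolution n α β 1 0 0 (n - 1)

/-- Type 2: residues conjugate to `p = diag(1, 0, …, 0)`, `q = 0`. -/
def ExistsMaximalType2 (n : ℕ) (α β : ℂ) : Prop :=
  ExistsMaximalSolution n α β 0 1 0 (n - 1)

/-- Type 3: residues conjugate to `p = 0`, `q = diag(1, 0, …, 0)`. -/
def ExistsMaximalType3 (n : ℕ) (α β : ℂ) : Prop :=
  ExistsMaximalSolution n α β 0 0 1 (n - 1)

end MatrixP4

end

noncomputable section

namespace MatrixP4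

/-! ### Laurent series as coefficient sequences, and conjugation of solutions -/

section Series

variable {n : ℕ}

/-! Put γ = -3 - α - β. Swapping u and v swaps α and β, and (u, v) ↦ (v - u, -u) permutes (α, β, γ)
cyclically. On residues these maps permute the three types, so everything reduces to type 2
(`existsMaximalType3_iff_type2`, `existsMaximalType1_iff_type3`).

Normalize the residues to e₁ = diag(1, 0, …, 0) and 0. The equation for the coefficient of t ^ k in
v is then a scalar equation at each entry (i, j), with linear factor `resonance β i j - k`. The
resonance is 2 at the corner, -β in the rest of the first row, 2 + β in the rest of the first
column, and 0 elsewhere. In the equation for u the factor is k + `firstInd i` + `firstInd j`, which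
vanishes only for k = 0 outside the first row and column. The available constants are therefore z₀
(one), the conjugates of e₁ (2(n - 1)), a block of x₀ ((n - 1)²), together n², and at most one for
each entry of v, available only where the resonance is a natural number.

Necessity: 2n² constants force all n² entries of v to be resonant (`variation_eq_zero`,
`resonance_nat_of_maximal`). Then -β and 2 + β are natural numbers with sum 2.

Sufficiency: for β = 0, -1, -2 the obstruction at each resonance vanishes, because vanishing first
rows or columns of the earlier coefficients are inherited by products (`compatibility_zero`,
`compatibility_neg_one`, `compatibility_neg_two`). The recursion is then solvable with free resonant
entries, and a unipotent conjugation supplies the orbit of e₁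
(`existsMaximalType2_of_compatibility`). -/

/-- The common quadratic form of the two equations of the system. -/
def quadForm (γ : ℂ) (a b a' b' : Matrix (Fin n) (Fin n) ℂ) : Matrix (Fin n) (Fin n) ℂ :=
  -(a * a') + (2 + γ) • (a * b') - γ • (b * a')

/-- The system for the coefficients `A m`, `B m` of `t ^ (m - 1)` in `u` and `v`. -/
def IsSeqSolution (α β : ℂ) (A B : ℕ → Matrix (Fin n) (Fin n) ℂ) : Prop :=
  ∀ m : ℕ,
    ((m : ℂ) - 1) • A m =
      ∑ i ∈ Finset.range (m + 1), quadForm α (A i) (B i) (A (m - i)) (B (m - i)) ∧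
    ((m : ℂ) - 1) • B m =
      ∑ i ∈ Finset.range (m + 1), quadForm β (B i) (A i) (B (m - i)) (A (m - i))

/-- The Laurent series `∑ A m t ^ (m - 1)`. -/
def laurentOfSeq (A : ℕ → Matrix (Fin n) (Fin n) ℂ) : MatLaurent n :=
  HahnSeries.ofSuppBddBelow (fun k : ℤ => if k < -1 then 0 else A (k + 1).toNat) <| by
    refine ⟨-1, fun k hk => ?_⟩
    by_contra h
    simp [not_le.mp h] at hk

lemma laurentOfSeq_coeff (A : ℕ → Matrix (Fin n) (Fin n) ℂ) (k : ℤ) :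
    (laurentOfSeq A).coeff k = if k < -1 then 0 else A (k + 1).toNat := rfl

lemma laurentOfSeq_coeff_nat (A : ℕ → Matrix (Fin n) (Fin n) ℂ) (m : ℕ) :
    (laurentOfSeq A).coeff ((m : ℤ) - 1) = A m := by
  rw [laurentOfSeq_coeff, if_neg (by omega)]
  congr 1
  omega

/-- Term m of a sequence sits at t ^ (m - 1), so terms i and m - i multiply into t ^ (m - 2), which
is also where the derivative of term m lands. -/
lemma coeff_mul_of_pole {u v : MatLaurent n} (hu : ∀ k : ℤ, k < -1 → u.coeff k = 0)
    (hv : ∀ k : ℤ, k < -1 → v.coeff k = 0) (m : ℕ) :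
    (u * v).coeff ((m : ℤ) - 2) = ∑ i ∈ Finset.range (m + 1),
      u.coeff ((i : ℤ) - 1) * v.coeff (((m - i : ℕ) : ℤ) - 1) := by
  have hu' : ∀ k : ℤ, u.coeff k ≠ 0 → -1 ≤ k := fun k h => by
    by_contra h'; exact h (hu k (by omega))
  have hv' : ∀ k : ℤ, v.coeff k ≠ 0 → -1 ≤ k := fun k h => by
    by_contra h'; exact h (hv k (by omega))
  rw [HahnSeries.coeff_mul]
  refine Finset.sum_of_injOn (fun ij => (ij.1 + 1).toNat) ?_ ?_ ?_ ?_
  · rintro ⟨a, b⟩ h ⟨c, d⟩ h' e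
    simp only [Finset.mem_coe, Finset.mem_antidiagonal, HahnSeries.mem_support] at h h'
    have := hu' _ h.1
    have := hu' _ h'.1
    simp only [Prod.mk.injEq] at e ⊢
    omega
  · rintro ⟨a, b⟩ h
    simp only [Finset.mem_coe, Finset.mem_antidiagonal, HahnSeries.mem_support] at h
    have := hu' _ h.1
    have := hv' _ h.2.1
    simp only [Finset.coe_range, Set.mem_Iio]
    omega
  · intro i hi h
    rw [Finset.mem_range] at hi
    by_contra h0
    refine h ⟨((i : ℤ) - 1, ((m - i : ℕ) : ℤ) - 1), ?_, by simp⟩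
    simp only [Finset.mem_coe, Finset.mem_antidiagonal, HahnSeries.mem_support]
    exact ⟨left_ne_zero_of_mul h0, right_ne_zero_of_mul h0, by omega⟩
  · rintro ⟨a, b⟩ h
    simp only [Finset.mem_antidiagonal, HahnSeries.mem_support] at h
    have := hu' _ h.1
    have := hv' _ h.2.1
    congr 2 <;> simp only <;> omega

lemma coeff_mul_eq_zero_of_pole {u v : MatLaurent n} (hu : ∀ k : ℤ, k < -1 → u.coeff k = 0)
    (hv : ∀ k : ℤ, k < -1 → v.coeff k = 0) {k : ℤ} (hk : k < -2) :
    (u * v).coeff k = 0 := by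
  rw [HahnSeries.coeff_mul]
  refine Finset.sum_eq_zero fun ij h => ?_
  rw [Finset.mem_antidiagonal] at h
  by_cases h1 : ij.1 < -1
  · rw [hu _ h1, zero_mul]
  · rw [hv _ (by omega), mul_zero]

lemma isFormalSolution_iff (α β : ℂ) (u v : MatLaurent n) :
    IsFormalSolution α β u v ↔
      (∀ k : ℤ, k < -1 → u.coeff k = 0) ∧ (∀ k : ℤ, k < -1 → v.coeff k = 0) ∧
        IsSeqSolution α β (fun m => u.coeff ((m : ℤ) - 1)) (fun m => v.coeff ((m : ℤ) - 1)) := by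
  have key : ∀ (γ : ℂ) (a b : MatLaurent n), (∀ k : ℤ, k < -1 → a.coeff k = 0) →
      (∀ k : ℤ, k < -1 → b.coeff k = 0) →
      (LaurentSeries.derivative ℂ a = -(a * a) + (2 : ℂ) • (a * b) + γ • (a * b - b * a) ↔
        ∀ m : ℕ, ((m : ℂ) - 1) • a.coeff ((m : ℤ) - 1) =
          ∑ i ∈ Finset.range (m + 1), quadForm γ (a.coeff ((i : ℤ) - 1)) (b.coeff ((i : ℤ) - 1))
            (a.coeff (((m - i : ℕ) : ℤ) - 1)) (b.coeff (((m - i : ℕ) : ℤ) - 1))) := by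
    intro γ a b ha hb
    have hR : ∀ m : ℕ, (-(a * a) + (2 : ℂ) • (a * b) + γ • (a * b - b * a)).coeff ((m : ℤ) - 2) =
        ∑ i ∈ Finset.range (m + 1), quadForm γ (a.coeff ((i : ℤ) - 1)) (b.coeff ((i : ℤ) - 1))
            (a.coeff (((m - i : ℕ) : ℤ) - 1)) (b.coeff (((m - i : ℕ) : ℤ) - 1)) := by
      intro m
      simp only [quadForm, Finset.sum_sub_distrib, Finset.sum_add_distrib, Finset.sum_neg_distrib,
        ← Finset.smul_sum, HahnSeries.coeff_add, HahnSeries.coeff_neg, HahnSeries.coeff_smul,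
        HahnSeries.coeff_sub]
      rw [coeff_mul_of_pole ha ha, coeff_mul_of_pole ha hb, coeff_mul_of_pole hb ha]
      module
    have hL : ∀ m : ℕ, (LaurentSeries.derivative ℂ a).coeff ((m : ℤ) - 2) =
        ((m : ℂ) - 1) • a.coeff ((m : ℤ) - 1) := by
      intro m
      rw [LaurentSeries.derivative_apply, LaurentSeries.hasseDeriv_coeff, Ring.choose_one_right,
        show (m : ℤ) - 2 + (1 : ℕ) = (m : ℤ) - 1 by push_cast; ring, ← Int.cast_smul_eq_zsmul ℂ]
      push_cast
      rfl
    constructor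
    · intro h m
      rw [← hR, ← hL, h]
    · intro h
      ext1
      funext k
      rcases lt_or_ge k (-2) with hk | hk
      · rw [LaurentSeries.derivative_apply, LaurentSeries.hasseDeriv_coeff,
          ha _ (by push_cast; omega)]
        simp [coeff_mul_eq_zero_of_pole ha ha hk, coeff_mul_eq_zero_of_pole ha hb hk,
          coeff_mul_eq_zero_of_pole hb ha hk]
      · obtain ⟨m, rfl⟩ : ∃ m : ℕ, k = (m : ℤ) - 2 := ⟨(k + 2).toNat, by omega⟩
        rw [hL, hR, h]
  constructor
  · rintro ⟨hu, hv, h1, h2⟩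
    exact ⟨hu, hv, fun m => ⟨(key α u v hu hv).1 h1 m, (key β v u hv hu).1 h2 m⟩⟩
  · rintro ⟨hu, hv, h⟩
    exact ⟨hu, hv, (key α u v hu hv).2 fun m => (h m).1, (key β v u hv hu).2 fun m => (h m).2⟩

lemma IsSeqSolution.isFormalSolution {α β : ℂ} {A B : ℕ → Matrix (Fin n) (Fin n) ℂ}
    (h : IsSeqSolution α β A B) : IsFormalSolution α β (laurentOfSeq A) (laurentOfSeq B) := by
  rw [isFormalSolution_iff]
  refine ⟨fun k hk => by rw [laurentOfSeq_coeff, if_pos hk],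
    fun k hk => by rw [laurentOfSeq_coeff, if_pos hk], ?_⟩
  simpa only [laurentOfSeq_coeff_nat] using h

lemma quadForm_conj (γ : ℂ) (S T a b a' b' : Matrix (Fin n) (Fin n) ℂ) (h : T * S = 1) :
    quadForm γ (S * a * T) (S * b * T) (S * a' * T) (S * b' * T) =
      S * quadForm γ a b a' b' * T := by
  have : ∀ x y : Matrix (Fin n) (Fin n) ℂ, S * x * T * (S * y * T) = S * (x * y) * T := by
    intro x y
    calc S * x * T * (S * y * T) = S * x * (T * S) * y * T := by noncomm_ring
      _ = _ := by rw [h]; noncomm_ring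
  simp only [quadForm, this, mul_add, mul_sub, add_mul, sub_mul, mul_neg, neg_mul,
    Matrix.mul_smul, Matrix.smul_mul]

lemma IsSeqSolution.conj {α β : ℂ} {A B : ℕ → Matrix (Fin n) (Fin n) ℂ}
    (h : IsSeqSolution α β A B) {S T : Matrix (Fin n) (Fin n) ℂ} (hTS : T * S = 1) :
    IsSeqSolution α β (fun m => S * A m * T) (fun m => S * B m * T) := by
  intro m
  simp only [quadForm_conj _ S T _ _ _ _ hTS, ← Finset.mul_sum, ← Finset.sum_mul]
  rw [← (h m).1, ← (h m).2]
  simp only [Matrix.mul_smul, Matrix.smul_mul, and_self]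

end Series

/-! ### Symmetries of the system and reduction to type 2 -/

section Transform

variable {n : ℕ}

/-- A linear invertible change of the unknowns carries a family of formal solutions into one. -/
lemma IsSolutionFamily.linear_change {α β α' β' : ℂ} {N : ℕ} {U : Set (Fin N → ℂ)}
    {z₀ : (Fin N → ℂ) → ℂ} {u v : (Fin N → ℂ) → MatLaurent n}
    (h : IsSolutionFamily α β N U z₀ u v) (a b c d a' b' c' d' : ℂ)
    (h11 : a' * a + b' * c = 1) (h12 : a' * b + b' * d = 0)
    (h21 : c' * a + d' * c = 0) (h22 : c' * b + d' * d = 1)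
    (hsol : ∀ w ∈ U, IsFormalSolution α' β' (a • u w + b • v w) (c • u w + d • v w)) :
    IsSolutionFamily α' β' N U z₀ (fun w => a • u w + b • v w) (fun w => c • u w + d • v w) := by
  have hdiff : ∀ (a b : ℂ) (k : ℤ) (i j : Fin n), DifferentiableOn ℂ
      (fun w => (a • u w + b • v w).coeff k i j) U := fun a b k i j => by
    have h1 := (h.differentiableOn_u k i j).const_mul a
    have h2 := (h.differentiableOn_v k i j).const_mul b
    exact h1.add h2
  refine ⟨h.isOpen, h.nonempty, hsol, h.differentiableOn_pole, hdiff a b, hdiff c d, ?_⟩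
  intro w hw ξ hz hu hv
  -- Every combination of the new unknowns has zero differential along ξ; the rows of the inverse
  -- matrix then recover u and v.
  have key : ∀ a' b' : ℂ, ∀ (k : ℤ) (i j : Fin n), fderiv ℂ (fun w' =>
      a' * (a • u w' + b • v w').coeff k i j + b' * (c • u w' + d • v w').coeff k i j) w ξ = 0 := by
    intro a' b' k i j
    have h1 := (hdiff a b k i j).differentiableAt (h.isOpen.mem_nhds hw)
    have h2 := (hdiff c d k i j).differentiableAt (h.isOpen.mem_nhds hw)
    rw [fderiv_fun_add (h1.const_mul a') (h2.const_mul b'), fderiv_const_mul h1,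
      fderiv_const_mul h2]
    rw [add_apply, smul_apply, smul_apply, hu, hv, smul_zero, smul_zero, add_zero]
  refine h.independent w hw ξ hz (fun k i j => ?_) (fun k i j => ?_)
  · rw [← key a' b' k i j]
    congr 2
    funext w'
    simp only [HahnSeries.coeff_add, HahnSeries.coeff_smul, Matrix.add_apply, Matrix.smul_apply,
      smul_eq_mul]
    linear_combination (-(u w').coeff k i j) * h11 - (v w').coeff k i j * h12
  · rw [← key c' d' k i j]
    congr 2
    funext w'
    simp only [HahnSeries.coeff_add, HahnSeries.coeff_smul, Matrix.add_apply, Matrix.smul_apply,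
      smul_eq_mul]
    linear_combination (-(u w').coeff k i j) * h21 - (v w').coeff k i j * h22

lemma IsFormalSolution.swap {α β : ℂ} {u v : MatLaurent n} (h : IsFormalSolution α β u v) :
    IsFormalSolution β α v u :=
  ⟨h.pole_v, h.pole_u, h.eq_v, h.eq_u⟩

lemma system_sub_neg_left {R : Type*} [Ring R] [Module ℂ R] (α β : ℂ) (u v : R) :
    -(v * v) + (2 : ℂ) • (v * u) + β • (v * u - u * v) -
        (-(u * u) + (2 : ℂ) • (u * v) + α • (u * v - v * u)) =
      -((v - u) * (v - u)) + (2 : ℂ) • ((v - u) * -u) +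
        (-3 - α - β) • ((v - u) * -u - -u * (v - u)) := by
  simp only [mul_sub, sub_mul, mul_neg, neg_mul]
  module

lemma system_sub_neg_right {R : Type*} [Ring R] [Module ℂ R] (α : ℂ) (u v : R) :
    -(-(u * u) + (2 : ℂ) • (u * v) + α • (u * v - v * u)) =
      -(-u * -u) + (2 : ℂ) • (-u * (v - u)) + α • (-u * (v - u) - (v - u) * -u) := by
  simp only [mul_sub, sub_mul, mul_neg, neg_mul]
  module

/-- The substitution has order three and permutes α, β and -3 - α - β cyclically. -/
lemma IsFormalSolution.sub_neg {α β : ℂ} {u v : MatLaurent n} (h : IsFormalSolution α β u v) :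
    IsFormalSolution (-3 - α - β) α (v - u) (-u) := by
  refine ⟨fun k hk => ?_, fun k hk => ?_, ?_, ?_⟩
  · simp [h.pole_u k hk, h.pole_v k hk]
  · simp [h.pole_u k hk]
  · rw [map_sub, h.eq_u, h.eq_v]
    exact system_sub_neg_left α β u v
  · rw [map_neg, h.eq_u]
    exact system_sub_neg_right α u v

/-- This is the inverse of the substitution in `sub_neg`, obtained by conjugating that one with the
swap. -/
lemma IsFormalSolution.neg_sub {α β : ℂ} {u v : MatLaurent n} (h : IsFormalSolution α β u v) :
    IsFormalSolution β (-3 - α - β) (-v) (u - v) := by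
  have := h.swap.sub_neg.swap
  rwa [show -3 - β - α = -3 - α - β by ring] at this

lemma resP_one_zero : resP n 1 0 = -resQ n 0 0 1 := by
  rw [resP, resQ, Matrix.diagonal_neg]
  congr 1
  funext i
  by_cases h : (i : ℕ) = 0 <;> simp [h]

lemma resQ_one_zero_zero : resQ n 1 0 0 = -resQ n 0 0 1 := by
  rw [resQ, resQ, Matrix.diagonal_neg]
  congr 1
  funext i
  by_cases h : (i : ℕ) = 0 <;> simp [h]

lemma resP_zero_one : resP n 0 1 = resQ n 0 0 1 := by
  simp [resP, resQ]

lemma resP_zero_zero : resP n 0 0 = 0 := by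
  simp [resP]

lemma resQ_zero_one_zero : resQ n 0 1 0 = 0 := by
  rw [resQ, ← Matrix.diagonal_zero]
  congr 1
  funext i
  by_cases h : (i : ℕ) = 0 <;> simp [h]

lemma existsMaximalType3_iff_type2 (α β : ℂ) :
    ExistsMaximalType3 n α β ↔ ExistsMaximalType2 n β α := by
  constructor <;> rintro ⟨U, z₀, u, v, h, hres⟩
  · refine ⟨U, z₀, _, _, h.linear_change 0 1 1 0 0 1 1 0 (by simp) (by simp) (by simp) (by simp)
      fun w hw => by
        convert (h.isFormalSolution w hw).swap using 1 <;> module, fun w hw => ?_⟩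
    obtain ⟨hn, S, hp, hq⟩ := hres w hw
    refine ⟨by omega, S, ?_, ?_⟩
    · rw [resP_zero_one]; simpa using hq
    · rw [resQ_zero_one_zero]; simpa [resP_zero_zero] using hp
  · refine ⟨U, z₀, _, _, h.linear_change 0 1 1 0 0 1 1 0 (by simp) (by simp) (by simp) (by simp)
      fun w hw => by
        convert (h.isFormalSolution w hw).swap using 1 <;> module, fun w hw => ?_⟩
    obtain ⟨hn, S, hp, hq⟩ := hres w hw
    refine ⟨by omega, S, ?_, ?_⟩
    · rw [resP_zero_zero]; simpa [resQ_zero_one_zero] using hq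
    · rw [← resP_zero_one]; simpa using hp

/-- On residues (p, q) ↦ (q - p, -p) sends (-e₁, -e₁) to (0, e₁). -/
lemma existsMaximalType1_iff_type3 (α β : ℂ) :
    ExistsMaximalType1 n α β ↔ ExistsMaximalType3 n (-3 - α - β) α := by
  constructor <;> rintro ⟨U, z₀, u, v, h, hres⟩
  · refine ⟨U, z₀, _, _, h.linear_change (-1) 1 (-1) 0 0 (-1) 1 (-1) (by simp) (by simp) (by simp)
      (by simp) fun w hw => by
        convert (h.isFormalSolution w hw).sub_neg using 1 <;> module, fun w hw => ?_⟩
    obtain ⟨hn, S, hp, hq⟩ := hres w hw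
    refine ⟨by omega, S, ?_, ?_⟩
    · simp [hp, hq, resP_zero_zero, resP_one_zero, resQ_one_zero_zero]
    · simp [hp, resP_one_zero]
  · refine ⟨U, z₀, _, _, h.linear_change 0 (-1) 1 (-1) (-1) 1 (-1) 0 (by simp) (by simp) (by simp)
      (by simp) fun w hw => by
        convert (h.isFormalSolution w hw).neg_sub using 1
        · ring
        · module
        · module, fun w hw => ?_⟩
    obtain ⟨hn, S, hp, hq⟩ := hres w hw
    refine ⟨by omega, S, ?_, ?_⟩
    · simp [hq, resP_one_zero]
    · simp [hp, hq, resP_zero_zero, resQ_one_zero_zero]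

end Transform

/-! ### Entrywise directional derivatives of matrix functions -/

section Derivative

variable {n : ℕ} {E : Type*} [NormedAddCommGroup E] [NormedSpace ℂ E]

/-- The entries of `A` are differentiable at `w`, and `D` is the matrix of their derivatives in
the direction `ξ`. -/
def HasMatDeriv (A : E → Matrix (Fin n) (Fin n) ℂ) (D : Matrix (Fin n) (Fin n) ℂ) (w ξ : E) :
    Prop :=
  ∀ i j, DifferentiableAt ℂ (fun w' => A w' i j) w ∧ fderiv ℂ (fun w' => A w' i j) w ξ = D i j

variable {A B A' B' : E → Matrix (Fin n) (Fin n) ℂ} {D D' DA DB DA' DB' : Matrix (Fin n) (Fin n) ℂ}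
  {w ξ : E}

lemma hasMatDeriv_of_differentiableAt
    (h : ∀ i j, DifferentiableAt ℂ (fun w' => A w' i j) w) (ξ : E) :
    HasMatDeriv A (Matrix.of fun i j => fderiv ℂ (fun w' => A w' i j) w ξ) w ξ :=
  fun i j => ⟨h i j, rfl⟩

/-- Serves to differentiate identities: the two sides are one function near w, so their derivatives
agree. -/
lemma HasMatDeriv.unique (h : HasMatDeriv A D w ξ) (h' : HasMatDeriv A D' w ξ) : D = D' := by
  ext i j
  rw [← (h i j).2, (h' i j).2]

lemma HasMatDeriv.congr (h : HasMatDeriv A D w ξ) (hAB : A =ᶠ[nhds w] B) :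
    HasMatDeriv B D w ξ := fun i j => by
  have e : (fun w' => A w' i j) =ᶠ[nhds w] fun w' => B w' i j :=
    hAB.mono fun w' h => by simp only [h]
  exact ⟨(h i j).1.congr_of_eventuallyEq e.symm, by rw [← e.fderiv_eq, (h i j).2]⟩

lemma hasMatDeriv_const (M : Matrix (Fin n) (Fin n) ℂ) (w ξ : E) :
    HasMatDeriv (fun _ => M) 0 w ξ := fun i j => by
  refine ⟨differentiableAt_const _, ?_⟩
  rw [fderiv_const_apply]
  rfl

lemma HasMatDeriv.add (h : HasMatDeriv A D w ξ) (h' : HasMatDeriv B D' w ξ) :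
    HasMatDeriv (fun w => A w + B w) (D + D') w ξ := fun i j => by
  refine ⟨(h i j).1.add (h' i j).1, ?_⟩
  simp only [Matrix.add_apply]
  rw [fderiv_fun_add (h i j).1 (h' i j).1, add_apply, (h i j).2, (h' i j).2]

lemma HasMatDeriv.const_smul (h : HasMatDeriv A D w ξ) (c : ℂ) :
    HasMatDeriv (fun w => c • A w) (c • D) w ξ := fun i j => by
  refine ⟨(h i j).1.const_mul c, ?_⟩
  simp only [Matrix.smul_apply, smul_eq_mul]
  rw [fderiv_const_mul (h i j).1, smul_apply, (h i j).2, smul_eq_mul]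

lemma HasMatDeriv.sum {ι : Type*} (s : Finset ι) {A : ι → E → Matrix (Fin n) (Fin n) ℂ}
    {D : ι → Matrix (Fin n) (Fin n) ℂ} (h : ∀ i ∈ s, HasMatDeriv (A i) (D i) w ξ) :
    HasMatDeriv (fun w => ∑ i ∈ s, A i w) (∑ i ∈ s, D i) w ξ := by
  classical
  induction s using Finset.induction_on with
  | empty => simpa using hasMatDeriv_const 0 w ξ
  | insert a s ha ih =>
    simp only [Finset.sum_insert ha]
    exact (h a (by simp)).add (ih fun i hi => h i (by simp [hi]))

lemma HasMatDeriv.mul (h : HasMatDeriv A D w ξ) (h' : HasMatDeriv B D' w ξ) :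
    HasMatDeriv (fun w => A w * B w) (D * B w + A w * D') w ξ := fun i j => by
  simp only [Matrix.mul_apply, Matrix.add_apply]
  have hd : ∀ k ∈ Finset.univ, DifferentiableAt ℂ (fun w => A w i k * B w k j) w :=
    fun k _ => (h i k).1.mul (h' k j).1
  refine ⟨DifferentiableAt.fun_sum hd, ?_⟩
  rw [fderiv_fun_sum hd, sum_apply, ← Finset.sum_add_distrib]
  refine Finset.sum_congr rfl fun k _ => ?_
  rw [fderiv_fun_mul (h i k).1 (h' k j).1, add_apply, smul_apply, smul_apply, (h i k).2,
    (h' k j).2, smul_eq_mul, smul_eq_mul]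
  ring

lemma HasMatDeriv.conj (h : HasMatDeriv A D w ξ) (S T : Matrix (Fin n) (Fin n) ℂ) :
    HasMatDeriv (fun w => S * A w * T) (S * D * T) w ξ := by
  simpa using ((hasMatDeriv_const S w ξ).mul h).mul (hasMatDeriv_const T w ξ)

lemma HasMatDeriv.quadForm (γ : ℂ) (hA : HasMatDeriv A DA w ξ) (hB : HasMatDeriv B DB w ξ)
    (hA' : HasMatDeriv A' DA' w ξ) (hB' : HasMatDeriv B' DB' w ξ) :
    HasMatDeriv (fun w => quadForm γ (A w) (B w) (A' w) (B' w))
      (quadForm γ DA DB (A' w) (B' w) + quadForm γ (A w) (B w) DA' DB') w ξ := by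
  have := (((hA.mul hA').const_smul (-1)).add ((hA.mul hB').const_smul (2 + γ))).add
    ((hB.mul hA').const_smul (-γ))
  convert this using 1
  · funext w
    simp only [MatrixP4.quadForm]
    module
  · simp only [MatrixP4.quadForm]
    module

end Derivative

/-! ### The linearized recursion and its resonances -/

section Linearization

variable {n : ℕ}

lemma sum_range_add_two {M : Type*} [AddCommMonoid M] (f : ℕ → M) (k : ℕ) :
    ∑ i ∈ Finset.range (k + 1 + 1), f i = f 0 + f (k + 1) + ∑ i ∈ Finset.range k, f (i + 1) := by
  rw [Finset.sum_range_succ', Finset.sum_range_succ]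
  abel

/-- The diagonal entries of `diag(1, 0, …, 0)`. -/
def firstInd (i : Fin n) : ℂ := if (i : ℕ) = 0 then 1 else 0

lemma resP_zero_one_eq : resP n 0 1 = Matrix.diagonal firstInd := by
  rw [resP]
  congr 1
  funext i
  simp [firstInd]

lemma firstInd_eq (i : Fin n) : firstInd i = 0 ∨ firstInd i = 1 := by
  unfold firstInd
  split_ifs <;> simp

lemma eq_of_firstInd {i j : Fin n} (hi : firstInd i ≠ 0) (hj : firstInd j ≠ 0) : i = j := by
  simp only [firstInd, ne_eq, ite_eq_right_iff, one_ne_zero, imp_false, not_not] at hi hj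
  exact Fin.ext (hi.trans hj.symm)

/-- The eigenvalue of the linearized equation for `v` on the entry `(i, j)`. -/
def resonance (β : ℂ) (i j : Fin n) : ℂ := (2 + β) * firstInd j - β * firstInd i

lemma quadForm_zero {γ : ℂ} (a b : Matrix (Fin n) (Fin n) ℂ) : quadForm γ a b 0 0 = 0 := by
  simp [quadForm]

lemma zero_quadForm {γ : ℂ} (a b : Matrix (Fin n) (Fin n) ℂ) : quadForm γ 0 0 a b = 0 := by
  simp [quadForm]

lemma quadForm_diag_apply (γ : ℂ) (x y : Matrix (Fin n) (Fin n) ℂ) (i j : Fin n) :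
    (quadForm γ (Matrix.diagonal firstInd) 0 x y + quadForm γ x y (Matrix.diagonal firstInd) 0) i j
      = -(firstInd i + firstInd j) * x i j
        + ((2 + γ) * firstInd i - γ * firstInd j) * y i j := by
  simp [quadForm, Matrix.diagonal_mul, Matrix.mul_diagonal]
  ring

/-- Since q = 0, the new coefficient x drops out: the system is triangular, y being determined first
and then entering the equation for x. -/
lemma quadForm_diag_apply' (γ : ℂ) (x y : Matrix (Fin n) (Fin n) ℂ) (i j : Fin n) :
    (quadForm γ 0 (Matrix.diagonal firstInd) y x + quadForm γ y x 0 (Matrix.diagonal firstInd)) i j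
      = resonance γ i j * y i j := by
  simp [quadForm, resonance, Matrix.diagonal_mul, Matrix.mul_diagonal]
  ring

lemma natCast_add_firstInd_eq_zero {k : ℕ} {i j : Fin n}
    (h : (k : ℂ) + firstInd i + firstInd j = 0) : k = 0 ∧ firstInd i = 0 ∧ firstInd j = 0 := by
  have h2 : ((k + 1 : ℕ) : ℂ) ≠ 0 := by exact_mod_cast Nat.succ_ne_zero k
  have h3 : ((k + 2 : ℕ) : ℂ) ≠ 0 := by exact_mod_cast Nat.succ_ne_zero (k + 1)
  push_cast at h2 h3
  rcases firstInd_eq i with hi | hi <;> rcases firstInd_eq j with hj | hj <;> rw [hi, hj] at h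
  · exact ⟨by simpa using h, hi, hj⟩
  · exact absurd (by linear_combination h) h2
  · exact absurd (by linear_combination h) h2
  · exact absurd (by linear_combination h) h3

variable {E : Type*} [NormedAddCommGroup E] [NormedSpace ℂ E]

/-- A variation of a solution with residues `diag(1, 0, …, 0)` and `0` vanishes if it vanishes
on the residues and on the resonant entries. -/
lemma variation_eq_zero {α β : ℂ} {A B : ℕ → E → Matrix (Fin n) (Fin n) ℂ}
    {DA DB : ℕ → Matrix (Fin n) (Fin n) ℂ} {w ξ : E}
    (hA : ∀ m, HasMatDeriv (A m) (DA m) w ξ) (hB : ∀ m, HasMatDeriv (B m) (DB m) w ξ)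
    (hsol : ∀ᶠ w' in nhds w, IsSeqSolution α β (fun m => A m w') (fun m => B m w'))
    (hA0 : A 0 w = Matrix.diagonal firstInd) (hB0 : B 0 w = 0)
    (hDA0 : DA 0 = 0) (hDB0 : DB 0 = 0)
    (hDA : ∀ i j, firstInd i = 0 → firstInd j = 0 → DA 1 i j = 0)
    (hDB : ∀ (k : ℕ) i j, resonance β i j = k → DB (k + 1) i j = 0) (m : ℕ) :
    DA m = 0 ∧ DB m = 0 := by
  induction m using Nat.strong_induction_on with
  | _ m ih =>
    rcases m with _ | k
    · exact ⟨hDA0, hDB0⟩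
    have hu := (HasMatDeriv.sum (Finset.range (k + 1 + 1)) fun i _ => HasMatDeriv.quadForm α
      (hA i) (hB i) (hA (k + 1 - i)) (hB (k + 1 - i))).unique
        (((hA (k + 1)).const_smul (((k + 1 : ℕ) : ℂ) - 1)).congr
          (hsol.mono fun w' h => (h (k + 1)).1))
    have hv := (HasMatDeriv.sum (Finset.range (k + 1 + 1)) fun i _ => HasMatDeriv.quadForm β
      (hB i) (hA i) (hB (k + 1 - i)) (hA (k + 1 - i))).unique
        (((hB (k + 1)).const_smul (((k + 1 : ℕ) : ℂ) - 1)).congr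
          (hsol.mono fun w' h => (h (k + 1)).2))
    -- Only the two extreme terms involve the variation of coefficient k + 1; the inner ones vanish
    -- by induction.
    rw [sum_range_add_two, Finset.sum_eq_zero, add_zero] at hu hv
    rotate_left
    · intro i hi
      rw [Finset.mem_range] at hi
      rw [(ih (i + 1) (by omega)).1, (ih (i + 1) (by omega)).2,
        (ih (k + 1 - (i + 1)) (by omega)).1, (ih (k + 1 - (i + 1)) (by omega)).2,
        quadForm_zero, zero_quadForm, add_zero]
    · intro i hi
      rw [Finset.mem_range] at hi
      rw [(ih (i + 1) (by omega)).1, (ih (i + 1) (by omega)).2,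
        (ih (k + 1 - (i + 1)) (by omega)).1, (ih (k + 1 - (i + 1)) (by omega)).2,
        quadForm_zero, zero_quadForm, add_zero]
    rw [hDA0, hDB0, zero_quadForm, zero_add, Nat.sub_zero, Nat.sub_self, hA0, hB0, hDA0, hDB0,
      quadForm_zero, add_zero] at hu hv
    have hy : DB (k + 1) = 0 := by
      ext i j
      have := congrFun (congrFun hv i) j
      rw [quadForm_diag_apply', Matrix.smul_apply, smul_eq_mul] at this
      by_cases hr : resonance β i j = k
      · exact hDB k i j hr
      · have h0 : (resonance β i j - k) * DB (k + 1) i j = 0 := by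
          push_cast at this
          linear_combination this
        exact (mul_eq_zero.1 h0).resolve_left (sub_ne_zero.2 hr)
    refine ⟨?_, hy⟩
    ext i j
    have := congrFun (congrFun hu i) j
    rw [quadForm_diag_apply, Matrix.smul_apply, smul_eq_mul, hy, Matrix.zero_apply] at this
    by_cases hr : (k : ℂ) + firstInd i + firstInd j = 0
    · obtain ⟨rfl, hi, hj⟩ := natCast_add_firstInd_eq_zero hr
      exact hDA i j hi hj
    · have h0 : ((k : ℂ) + firstInd i + firstInd j) * DA (k + 1) i j = 0 := by
        push_cast at this
        linear_combination -this
      exact (mul_eq_zero.1 h0).resolve_left hr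

end Linearization

/-! ### Necessity: a dimension count -/

section Necessity

variable {n : ℕ} {E : Type*} [NormedAddCommGroup E] [NormedSpace ℂ E]

/-- The values at a direction `ξ` of the differentials that determine a variation of a solution. -/
def resonantDifferentials (β : ℂ) (w : E) (z₀ : E → ℂ) (A B : ℕ → E → Matrix (Fin n) (Fin n) ℂ) :
    E →ₗ[ℂ] (Matrix (Fin n) (Fin n) ℂ) × (Matrix (Fin n) (Fin n) ℂ) :=
  open Classical in
  { toFun := fun ξ =>
      (Matrix.of fun i j =>
        if firstInd i = 0 then
          if firstInd j = 0 then fderiv ℂ (fun w' => A 1 w' i j) w ξ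
          else fderiv ℂ (fun w' => A 0 w' i j) w ξ
        else if firstInd j = 0 then fderiv ℂ (fun w' => A 0 w' i j) w ξ
          else fderiv ℂ z₀ w ξ,
      Matrix.of fun i j =>
        if h : ∃ k : ℕ, resonance β i j = k then
          fderiv ℂ (fun w' => B (h.choose + 1) w' i j) w ξ
        else 0)
    map_add' := fun x y => by
      ext i j <;> simp only [Prod.fst_add, Prod.snd_add, Matrix.add_apply, Matrix.of_apply] <;>
        split_ifs <;> simp
    map_smul' := fun c x => by
      ext i j <;> simp only [Prod.smul_fst, Prod.smul_snd, Matrix.smul_apply, Matrix.of_apply] <;>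
        split_ifs <;> simp }

/-- Independence of the parameters makes `resonantDifferentials` injective. Source and target both
have dimension 2n², so it is also surjective; but at a non-resonant entry its second component is
identically 0. -/
lemma resonance_nat_of_maximal (hn : 0 < n) {α β : ℂ} (h : ExistsMaximalType2 n α β) (i j : Fin n) :
    ∃ k : ℕ, resonance β i j = k := by
  obtain ⟨U, z₀, u, v, h, hres⟩ := h
  obtain ⟨w, hw⟩ := h.nonempty
  obtain ⟨-, S, hp, -⟩ := hres w hw
  have hTS : ((S⁻¹ : GL (Fin n) ℂ) : Matrix (Fin n) (Fin n) ℂ) * S = 1 := S.inv_mul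
  have hST : (S : Matrix (Fin n) (Fin n) ℂ) * (S⁻¹ : GL (Fin n) ℂ) = 1 := S.mul_inv
  generalize ((S⁻¹ : GL (Fin n) ℂ) : Matrix (Fin n) (Fin n) ℂ) = T at *
  generalize (S : Matrix (Fin n) (Fin n) ℂ) = S at *
  have hcancel : ∀ M : Matrix (Fin n) (Fin n) ℂ, S * (T * M * S) * T = M := fun M => by
    calc S * (T * M * S) * T = (S * T) * M * (S * T) := by noncomm_ring
      _ = M := by rw [hST]; noncomm_ring
  have hcancel' : ∀ M : Matrix (Fin n) (Fin n) ℂ, T * (S * M * T) * S = M := fun M => by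
    calc T * (S * M * T) * S = (T * S) * M * (T * S) := by noncomm_ring
      _ = M := by rw [hTS]; noncomm_ring
  have hU := h.isOpen.mem_nhds hw
  -- The conjugating matrix is frozen at the base point w, so no regularity of its dependence on the
  -- parameters is needed; p equals e₁ only at w.
  let A : ℕ → (Fin (2 * n ^ 2) → ℂ) → Matrix (Fin n) (Fin n) ℂ :=
    fun m w' => T * (u w').coeff ((m : ℤ) - 1) * S
  let B : ℕ → (Fin (2 * n ^ 2) → ℂ) → Matrix (Fin n) (Fin n) ℂ :=
    fun m w' => T * (v w').coeff ((m : ℤ) - 1) * S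
  have hA0 : A 0 w = Matrix.diagonal firstInd := by
    simp only [A, Nat.cast_zero, zero_sub]
    rw [hp, resP_zero_one_eq, hcancel']
  have hsol : ∀ᶠ w' in nhds w, IsSeqSolution α β (fun m => A m w') (fun m => B m w') := by
    filter_upwards [hU] with w' hw'
    exact ((isFormalSolution_iff _ _ _ _).1 (h.isFormalSolution w' hw')).2.2.conj hST
  have hB0 : ∀ᶠ w' in nhds w, B 0 w' = 0 := by
    filter_upwards [hU] with w' hw'
    obtain ⟨-, S', -, hq⟩ := hres w' hw'
    simp only [B, Nat.cast_zero, zero_sub]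
    rw [hq, resQ_zero_one_zero]
    simp
  have hu : ∀ m ξ, HasMatDeriv (fun w' => (u w').coeff ((m : ℤ) - 1))
      (Matrix.of fun i j => fderiv ℂ (fun w' => (u w').coeff ((m : ℤ) - 1) i j) w ξ) w ξ :=
    fun m ξ => hasMatDeriv_of_differentiableAt
      (fun i j => (h.differentiableOn_u _ i j).differentiableAt hU) ξ
  have hv : ∀ m ξ, HasMatDeriv (fun w' => (v w').coeff ((m : ℤ) - 1))
      (Matrix.of fun i j => fderiv ℂ (fun w' => (v w').coeff ((m : ℤ) - 1) i j) w ξ) w ξ :=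
    fun m ξ => hasMatDeriv_of_differentiableAt
      (fun i j => (h.differentiableOn_v _ i j).differentiableAt hU) ξ
  have hA : ∀ m ξ, HasMatDeriv (A m)
      (Matrix.of fun i j => fderiv ℂ (fun w' => A m w' i j) w ξ) w ξ :=
    fun m ξ => hasMatDeriv_of_differentiableAt (fun i j => ((hu m ξ).conj T S i j).1) ξ
  have hB : ∀ m ξ, HasMatDeriv (B m)
      (Matrix.of fun i j => fderiv ℂ (fun w' => B m w' i j) w ξ) w ξ :=
    fun m ξ => hasMatDeriv_of_differentiableAt (fun i j => ((hv m ξ).conj T S i j).1) ξ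
  have hinj : Function.Injective (resonantDifferentials β w z₀ A B) := by
    rw [← LinearMap.ker_eq_bot, LinearMap.ker_eq_bot']
    intro ξ hξ
    have h1 := fun i j => congrFun (congrFun (congrArg Prod.fst hξ) i) j
    have h2 := fun i j => congrFun (congrFun (congrArg Prod.snd hξ) i) j
    simp only [resonantDifferentials, LinearMap.coe_mk, AddHom.coe_mk, Matrix.of_apply,
      Prod.fst_zero, Prod.snd_zero, Matrix.zero_apply] at h1 h2
    have hDB0 : (Matrix.of fun i j => fderiv ℂ (fun w' => B 0 w' i j) w ξ) = 0 :=
      (hB 0 ξ).unique ((hasMatDeriv_const 0 w ξ).congr (hB0.mono fun w' h => h.symm))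
    -- The leading equation with q = 0 says p² = p. Differentiated at e₁, this kills the two
    -- diagonal blocks of the variation of p; the other two are among the recorded differentials.
    have hproj : ∀ᶠ w' in nhds w, A 0 w' * A 0 w' = A 0 w' := by
      filter_upwards [hsol, hB0] with w' h1 h2
      have := (h1 0).1
      simp only [Nat.cast_zero, zero_sub, zero_add, Finset.sum_range_one, quadForm, h2] at this
      simpa using this.symm
    have hDA0' := ((hA 0 ξ).mul (hA 0 ξ)).unique
      ((hA 0 ξ).congr (hproj.mono fun w' h => h.symm))
    rw [hA0] at hDA0'
    have hDA0 : (Matrix.of fun i j => fderiv ℂ (fun w' => A 0 w' i j) w ξ) = 0 := by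
      ext i j
      have h3 := congrFun (congrFun hDA0' i) j
      rw [Matrix.add_apply, Matrix.mul_diagonal, Matrix.diagonal_mul, Matrix.of_apply] at h3
      rw [Matrix.of_apply, Matrix.zero_apply]
      have h4 := h1 i j
      rcases firstInd_eq i with hi | hi <;> rcases firstInd_eq j with hj | hj <;>
        rw [hi, hj] at h3 h4
      · linear_combination -h3
      · simpa using h4
      · simpa using h4
      · linear_combination h3
    have key := variation_eq_zero (fun m => hA m ξ) (fun m => hB m ξ) hsol hA0 hB0.self_of_nhds
      hDA0 hDB0 (fun i j hi hj => by simpa [hi, hj] using h1 i j) (fun k i j hk => by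
        have h3 := h2 i j
        have hex : ∃ k : ℕ, resonance β i j = k := ⟨k, hk⟩
        rw [dif_pos hex] at h3
        have : hex.choose = k := by exact_mod_cast hex.choose_spec.symm.trans hk
        rwa [this] at h3)
    have hzero : ∀ (k : ℤ)
        (f : (Fin (2 * n ^ 2) → ℂ) → MatLaurent n), (∀ w' ∈ U, ∀ k < -1, (f w').coeff k = 0) →
        (∀ m : ℕ, HasMatDeriv (fun w' => T * (f w').coeff ((m : ℤ) - 1) * S) 0 w ξ) →
        HasMatDeriv (fun w' => (f w').coeff k) 0 w ξ := by
      intro k f hf hm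
      rcases lt_or_ge k (-1) with hk | hk
      · refine (hasMatDeriv_const 0 w ξ).congr ?_
        filter_upwards [hU] with w' hw'
        rw [hf w' hw' k hk]
      · obtain ⟨m, rfl⟩ : ∃ m : ℕ, k = (m : ℤ) - 1 := ⟨(k + 1).toNat, by omega⟩
        simpa [hcancel] using (hm m).conj S T
    refine h.independent w hw ξ ?_ (fun k i j => ?_) (fun k i j => ?_)
    · simpa [firstInd] using h1 ⟨0, hn⟩ ⟨0, hn⟩
    · exact (hzero k u (fun w' hw' => (h.isFormalSolution w' hw').pole_u)
        (fun m => (key m).1 ▸ hA m ξ) i j).2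
    · exact (hzero k v (fun w' hw' => (h.isFormalSolution w' hw').pole_v)
        (fun m => (key m).2 ▸ hB m ξ) i j).2
  have hsurj := (LinearMap.injective_iff_surjective_of_finrank_eq_finrank (by
    rw [Module.finrank_prod, Module.finrank_matrix, Module.finrank_fin_fun, Module.finrank_self]
    simp
    ring)).1 hinj
  by_contra hne
  obtain ⟨ξ, hξ⟩ := hsurj (0, Matrix.of fun _ _ => 1)
  have := congrFun (congrFun (congrArg Prod.snd hξ) i) j
  simp only [resonantDifferentials, LinearMap.coe_mk, AddHom.coe_mk, Matrix.of_apply] at this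
  rw [dif_neg hne] at this
  exact zero_ne_one this

lemma exists_int_of_existsMaximalType2 (hn : 2 ≤ n) {α β : ℂ} (h : ExistsMaximalType2 n α β) :
    ∃ m : ℤ, β = (m : ℂ) ∧ -2 ≤ m ∧ m ≤ 0 := by
  -- The entry (0, 1) has resonance -β and the entry (1, 0) has resonance 2 + β.
  obtain ⟨k, hk⟩ := resonance_nat_of_maximal (by omega) h ⟨0, by omega⟩ ⟨1, by omega⟩
  obtain ⟨l, hl⟩ := resonance_nat_of_maximal (by omega) h ⟨1, by omega⟩ ⟨0, by omega⟩
  simp only [resonance, firstInd, one_ne_zero, if_true, if_false] at hk hl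
  refine ⟨-k, by push_cast; linear_combination -hk, ?_, by omega⟩
  have : ((l + k : ℕ) : ℂ) = (2 : ℕ) := by push_cast; linear_combination -hk - hl
  have : l + k = 2 := by exact_mod_cast this
  omega

end Necessity

/-! ### Solving the recursion with free resonant entries -/

section Recursion

variable {n : ℕ}

/-- The coefficients `(x k, y k)` of the formal solution with residues `diag(1, 0, …, 0)` and `0`,
in which the resonant entries of `x` and `y` are those of `X` and `Y`. A quotient `F / 0 = 0`
occurs at the resonant entries only. -/
def regularCoeff (α β : ℂ) (X Y : Matrix (Fin n) (Fin n) ℂ) (k : ℕ) :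
    Matrix (Fin n) (Fin n) ℂ × Matrix (Fin n) (Fin n) ℂ :=
  let x : Fin k → Matrix (Fin n) (Fin n) ℂ := fun i => (regularCoeff α β X Y i).1
  let y : Fin k → Matrix (Fin n) (Fin n) ℂ := fun i => (regularCoeff α β X Y i).2
  let F : Matrix (Fin n) (Fin n) ℂ := ∑ i, quadForm α (x i) (y i) (x i.rev) (y i.rev)
  let G : Matrix (Fin n) (Fin n) ℂ := ∑ i, quadForm β (y i) (x i) (y i.rev) (x i.rev)
  let y' : Matrix (Fin n) (Fin n) ℂ := Matrix.of fun i j =>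
    G i j / (k - resonance β i j) + if resonance β i j = k then Y i j else 0
  (Matrix.of fun i j =>
    (F i j + ((2 + α) * firstInd i - α * firstInd j) * y' i j) / (k + firstInd i + firstInd j) +
      if (k : ℂ) + firstInd i + firstInd j = 0 then X i j else 0, y')
termination_by k

variable (α β : ℂ) (X Y : Matrix (Fin n) (Fin n) ℂ)

/-- The contribution of the lower coefficients to the equation for the coefficient `k` of `u`. -/
def forcingU (k : ℕ) : Matrix (Fin n) (Fin n) ℂ :=
  ∑ i ∈ Finset.range k, quadForm α (regularCoeff α β X Y i).1 (regularCoeff α β X Y i).2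
    (regularCoeff α β X Y (k - 1 - i)).1 (regularCoeff α β X Y (k - 1 - i)).2

/-- The contribution of the lower coefficients to the equation for the coefficient `k` of `v`. -/
def forcingV (k : ℕ) : Matrix (Fin n) (Fin n) ℂ :=
  ∑ i ∈ Finset.range k, quadForm β (regularCoeff α β X Y i).2 (regularCoeff α β X Y i).1
    (regularCoeff α β X Y (k - 1 - i)).2 (regularCoeff α β X Y (k - 1 - i)).1

lemma regularCoeff_snd_apply (k : ℕ) (i j : Fin n) :
    (regularCoeff α β X Y k).2 i j = forcingV α β X Y k i j / (k - resonance β i j) +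
      if resonance β i j = k then Y i j else 0 := by
  rw [regularCoeff, forcingV, ← Fin.sum_univ_eq_sum_range (fun i => quadForm β
    (regularCoeff α β X Y i).2 (regularCoeff α β X Y i).1
    (regularCoeff α β X Y (k - 1 - i)).2 (regularCoeff α β X Y (k - 1 - i)).1)]
  have : ∀ i : Fin k, (i.rev : ℕ) = k - 1 - i := fun i => by rw [Fin.val_rev]; omega
  simp only [Matrix.of_apply, this]

lemma regularCoeff_fst_apply (k : ℕ) (i j : Fin n) :
    (regularCoeff α β X Y k).1 i j = (forcingU α β X Y k i j +
      ((2 + α) * firstInd i - α * firstInd j) * (regularCoeff α β X Y k).2 i j) /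
        (k + firstInd i + firstInd j) +
      if (k : ℂ) + firstInd i + firstInd j = 0 then X i j else 0 := by
  rw [regularCoeff, forcingU, ← Fin.sum_univ_eq_sum_range (fun i => quadForm α
    (regularCoeff α β X Y i).1 (regularCoeff α β X Y i).2
    (regularCoeff α β X Y (k - 1 - i)).1 (regularCoeff α β X Y (k - 1 - i)).2)]
  have : ∀ i : Fin k, (i.rev : ℕ) = k - 1 - i := fun i => by rw [Fin.val_rev]; omega
  simp only [Matrix.of_apply, this]

/-- The sequence of coefficients whose first term is the residue. -/
def withResidue {M : Type*} (p : M) (x : ℕ → M) : ℕ → M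
  | 0 => p
  | k + 1 => x k

lemma isSeqSolution_withResidue
    (hcompat : ∀ (k : ℕ) i j, resonance β i j = k → forcingV α β X Y k i j = 0) :
    IsSeqSolution α β
      (withResidue (Matrix.diagonal firstInd) fun k => (regularCoeff α β X Y k).1)
      (withResidue 0 fun k => (regularCoeff α β X Y k).2) := by
  rintro (_ | k)
  · have : ∀ i : Fin n, firstInd i * firstInd i = firstInd i := fun i => by
      rcases firstInd_eq i with h | h <;> simp [h]
    simp [withResidue, quadForm, Matrix.diagonal_mul_diagonal, this]
  have hU : ∑ i ∈ Finset.range k, quadForm α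
      (withResidue (Matrix.diagonal firstInd) (fun k => (regularCoeff α β X Y k).1) (i + 1))
      (withResidue 0 (fun k => (regularCoeff α β X Y k).2) (i + 1))
      (withResidue (Matrix.diagonal firstInd) (fun k => (regularCoeff α β X Y k).1)
        (k + 1 - (i + 1)))
      (withResidue 0 (fun k => (regularCoeff α β X Y k).2) (k + 1 - (i + 1))) =
      forcingU α β X Y k := by
    refine Finset.sum_congr rfl fun i hi => ?_
    rw [Finset.mem_range] at hi
    rw [show k + 1 - (i + 1) = k - 1 - i + 1 by omega]
    rfl
  have hV : ∑ i ∈ Finset.range k, quadForm β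
      (withResidue 0 (fun k => (regularCoeff α β X Y k).2) (i + 1))
      (withResidue (Matrix.diagonal firstInd) (fun k => (regularCoeff α β X Y k).1) (i + 1))
      (withResidue 0 (fun k => (regularCoeff α β X Y k).2) (k + 1 - (i + 1)))
      (withResidue (Matrix.diagonal firstInd) (fun k => (regularCoeff α β X Y k).1)
        (k + 1 - (i + 1))) =
      forcingV α β X Y k := by
    refine Finset.sum_congr rfl fun i hi => ?_
    rw [Finset.mem_range] at hi
    rw [show k + 1 - (i + 1) = k - 1 - i + 1 by omega]
    rfl
  rw [sum_range_add_two, sum_range_add_two, hU, hV, Nat.sub_zero, Nat.sub_self]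
  simp only [withResidue, Nat.cast_add, Nat.cast_one, add_sub_cancel_right]
  constructor
  · ext i j
    rw [Matrix.add_apply, quadForm_diag_apply, Matrix.smul_apply, smul_eq_mul]
    have h := regularCoeff_fst_apply α β X Y k i j
    by_cases h0 : (k : ℂ) + firstInd i + firstInd j = 0
    · obtain ⟨rfl, hi, hj⟩ := natCast_add_firstInd_eq_zero h0
      -- Here k = 0: the forcing is an empty sum and the factor of y vanishes as well, so the
      -- equation for u imposes no condition.
      simp [hi, hj, forcingU]
    · rw [if_neg h0, add_zero, eq_div_iff h0] at h
      linear_combination h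
  · ext i j
    rw [Matrix.add_apply, quadForm_diag_apply', Matrix.smul_apply, smul_eq_mul]
    have h := regularCoeff_snd_apply α β X Y k i j
    by_cases h0 : resonance β i j = k
    · rw [hcompat k i j h0, h0, add_zero]
    · have h1 : (k : ℂ) - resonance β i j ≠ 0 := sub_ne_zero.2 (Ne.symm h0)
      rw [if_neg h0, add_zero, eq_div_iff h1] at h
      linear_combination h

end Recursion

/-! ### Vanishing of the obstructions for β = 0, -1, -2 -/

section Compatibility

variable {n : ℕ}

/-- The first row of `M` vanishes. -/
def FirstRowZero (M : Matrix (Fin n) (Fin n) ℂ) : Prop := ∀ i j, firstInd i = 1 → M i j = 0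

/-- The first column of `M` vanishes. -/
def FirstColZero (M : Matrix (Fin n) (Fin n) ℂ) : Prop := ∀ i j, firstInd j = 1 → M i j = 0

/-- A row of a product sees only that row of the left factor, and dually for columns and right
factors; hence no condition on the other pair. -/
lemma FirstRowZero.quadForm {γ : ℂ} {a b : Matrix (Fin n) (Fin n) ℂ} (ha : FirstRowZero a)
    (hb : FirstRowZero b) (a' b' : Matrix (Fin n) (Fin n) ℂ) :
    FirstRowZero (quadForm γ a b a' b') := fun i j hi => by
  simp [MatrixP4.quadForm, Matrix.mul_apply, ha i _ hi, hb i _ hi]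

lemma FirstColZero.quadForm {γ : ℂ} (a b : Matrix (Fin n) (Fin n) ℂ)
    {a' b' : Matrix (Fin n) (Fin n) ℂ} (ha : FirstColZero a') (hb : FirstColZero b') :
    FirstColZero (quadForm γ a b a' b') := fun i j hj => by
  simp [MatrixP4.quadForm, Matrix.mul_apply, ha _ j hj, hb _ j hj]

variable (α β : ℂ) (X Y : Matrix (Fin n) (Fin n) ℂ)

lemma firstRowZero_forcing {k : ℕ} (h : ∀ i < k, FirstRowZero (regularCoeff α β X Y i).1 ∧
    FirstRowZero (regularCoeff α β X Y i).2) :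
    FirstRowZero (forcingU α β X Y k) ∧ FirstRowZero (forcingV α β X Y k) := by
  constructor <;> intro i j hi <;> simp only [forcingU, forcingV, Matrix.sum_apply] <;>
    refine Finset.sum_eq_zero fun l hl => ?_ <;> rw [Finset.mem_range] at hl
  · exact (h l hl).1.quadForm (h l hl).2 _ _ i j hi
  · exact (h l hl).2.quadForm (h l hl).1 _ _ i j hi

lemma firstColZero_forcing {k : ℕ} (h : ∀ i < k, FirstColZero (regularCoeff α β X Y i).1 ∧
    FirstColZero (regularCoeff α β X Y i).2) :
    FirstColZero (forcingU α β X Y k) ∧ FirstColZero (forcingV α β X Y k) := by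
  constructor <;> intro i j hj <;> simp only [forcingU, forcingV, Matrix.sum_apply] <;>
    refine Finset.sum_eq_zero fun l hl => ?_ <;> rw [Finset.mem_range] at hl
  · exact FirstColZero.quadForm _ _ (h _ (by omega)).1 (h _ (by omega)).2 i j hj
  · exact FirstColZero.quadForm _ _ (h _ (by omega)).2 (h _ (by omega)).1 i j hj

variable {α β X Y}

lemma regularCoeff_apply_eq_zero {k : ℕ} {i j : Fin n} (hU : forcingU α β X Y k i j = 0)
    (hV : forcingV α β X Y k i j = 0) (hr : resonance β i j ≠ k)
    (hij : firstInd i = 1 ∨ firstInd j = 1) :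
    (regularCoeff α β X Y k).1 i j = 0 ∧ (regularCoeff α β X Y k).2 i j = 0 := by
  have hy : (regularCoeff α β X Y k).2 i j = 0 := by
    rw [regularCoeff_snd_apply, hV, if_neg hr]
    simp
  refine ⟨?_, hy⟩
  rw [regularCoeff_fst_apply, hU, hy, if_neg]
  · simp
  · intro h
    obtain ⟨-, hi, hj⟩ := natCast_add_firstInd_eq_zero h
    rcases hij with h | h <;> simp_all

/-- Without a resonance in the first row, zero forcing there yields zero coefficients, which in turn
keep the next forcing zero there. -/
lemma firstRowZero_regularCoeff {K : ℕ}
    (hr : ∀ k < K, ∀ i j : Fin n, firstInd i = 1 → resonance β i j ≠ k) (k : ℕ) (hk : k < K) :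
    FirstRowZero (regularCoeff α β X Y k).1 ∧ FirstRowZero (regularCoeff α β X Y k).2 := by
  induction k using Nat.strong_induction_on with
  | _ k ih =>
    obtain ⟨hU, hV⟩ := firstRowZero_forcing α β X Y fun i hi => ih i hi (by omega)
    have := fun i j hi => regularCoeff_apply_eq_zero (hU i j hi) (hV i j hi) (hr k hk i j hi)
      (Or.inl hi)
    exact ⟨fun i j hi => (this i j hi).1, fun i j hi => (this i j hi).2⟩

lemma firstColZero_regularCoeff {K : ℕ}
    (hr : ∀ k < K, ∀ i j : Fin n, firstInd j = 1 → resonance β i j ≠ k) (k : ℕ) (hk : k < K) :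
    FirstColZero (regularCoeff α β X Y k).1 ∧ FirstColZero (regularCoeff α β X Y k).2 := by
  induction k using Nat.strong_induction_on with
  | _ k ih =>
    obtain ⟨hU, hV⟩ := firstColZero_forcing α β X Y fun i hi => ih i hi (by omega)
    have := fun i j hj => regularCoeff_apply_eq_zero (hU i j hj) (hV i j hj) (hr k hk i j hj)
      (Or.inr hj)
    exact ⟨fun i j hj => (this i j hj).1, fun i j hj => (this i j hj).2⟩

/-- Resonances at k = 0 are never obstructed. -/
lemma forcingV_zero : forcingV α β X Y 0 = 0 := by simp [forcingV]

lemma compatibility_zero {k : ℕ} {i j : Fin n} (h : resonance 0 i j = k) :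
    forcingV α 0 X Y k i j = 0 := by
  rcases firstInd_eq j with hj | hj
  · simp only [resonance, hj, mul_zero, zero_mul, sub_zero] at h
    obtain rfl : k = 0 := by exact_mod_cast h.symm
    simp [forcingV_zero]
  · have hk : (2 : ℂ) = k := by simpa [resonance, hj] using h
    obtain rfl : 2 = k := by exact_mod_cast hk
    refine (firstColZero_forcing α 0 X Y (firstColZero_regularCoeff fun k hk i j hj e => ?_)).2
      i j hj
    have e : (2 : ℂ) = k := by simpa [resonance, hj] using e
    have : 2 = k := by exact_mod_cast e
    omega

/-- For β = -2 the resonance depends on the row only: it is 2 in the first row, which therefore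
stays zero in all coefficients below 2. -/
lemma compatibility_neg_two {k : ℕ} {i j : Fin n} (h : resonance (-2) i j = k) :
    forcingV α (-2) X Y k i j = 0 := by
  rcases firstInd_eq i with hi | hi
  · have hk : (0 : ℂ) = k := by simpa [resonance, hi] using h
    obtain rfl : k = 0 := by exact_mod_cast hk.symm
    simp [forcingV_zero]
  · have hk : (2 : ℂ) = k := by simpa [resonance, hi] using h
    obtain rfl : 2 = k := by exact_mod_cast hk
    refine (firstRowZero_forcing α (-2) X Y (firstRowZero_regularCoeff fun k hk i j hi e => ?_)).2
      i j hi
    have e : (2 : ℂ) = k := by simpa [resonance, hi] using e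
    have : 2 = k := by exact_mod_cast e
    omega

lemma resonance_neg_one (i j : Fin n) : resonance (-1) i j = firstInd i + firstInd j := by
  rw [resonance]
  ring

lemma compatibility_neg_one {k : ℕ} {i j : Fin n} (h : resonance (-1) i j = k) :
    forcingV α (-1) X Y k i j = 0 := by
  rw [resonance_neg_one] at h
  have hrow := firstRowZero_regularCoeff (α := α) (β := -1) (X := X) (Y := Y) (K := 1)
    fun k hk i j hi e => by
      obtain rfl : k = 0 := by omega
      rw [resonance_neg_one, Nat.cast_zero] at e
      rcases firstInd_eq j with hj | hj <;> rw [hi, hj] at e <;> norm_num at e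
  have hcol := firstColZero_regularCoeff (α := α) (β := -1) (X := X) (Y := Y) (K := 1)
    fun k hk i j hj e => by
      obtain rfl : k = 0 := by omega
      rw [resonance_neg_one, Nat.cast_zero] at e
      rcases firstInd_eq i with hi | hi <;> rw [hi, hj] at e <;> norm_num at e
  rcases firstInd_eq i with hi | hi <;> rcases firstInd_eq j with hj | hj <;> rw [hi, hj] at h
  · obtain rfl : k = 0 := by
      rw [add_zero] at h
      exact_mod_cast h.symm
    simp [forcingV_zero]
  · obtain rfl : k = 1 := by
      rw [zero_add] at h
      exact_mod_cast h.symm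
    exact (firstColZero_forcing α (-1) X Y hcol).2 i j hj
  · obtain rfl : k = 1 := by
      rw [add_zero] at h
      exact_mod_cast h.symm
    exact (firstRowZero_forcing α (-1) X Y hrow).2 i j hi
  · obtain rfl : k = 2 := by
      rw [one_add_one_eq_two] at h
      exact_mod_cast h.symm
    -- At the corner the forcing has two terms: in one the coefficients of index 0 stand on the left
    -- and kill the first row, in the other they stand on the right and kill the first column.
    have h0 := hrow 0 one_pos
    have h0' := hcol 0 one_pos
    rw [forcingV, Finset.sum_range_succ, Finset.sum_range_one, Matrix.add_apply,
      h0.2.quadForm h0.1 _ _ i j hi]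
    simp only [Nat.add_one_sub_one, Nat.sub_self]
    rw [FirstColZero.quadForm _ _ h0'.2 h0'.1 i j hj, add_zero]

end Compatibility

/-! ### A chart on the conjugates of diag(1, 0, …, 0) -/

section Conjugation

variable {n : ℕ}

local notation "e₁" => (Matrix.diagonal firstInd)

lemma diagonal_firstInd_mul_self : (e₁ * e₁ : Matrix (Fin n) (Fin n) ℂ) = e₁ := by
  rw [Matrix.diagonal_mul_diagonal]
  congr 1
  funext i
  rcases firstInd_eq i with h | h <;> simp [h]

/-- The part of `X` in the first column, outside the first row. -/
def colPart (X : Matrix (Fin n) (Fin n) ℂ) : Matrix (Fin n) (Fin n) ℂ := (1 - e₁) * X * e₁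

/-- The part of `X` in the first row, outside the first column. -/
def rowPart (X : Matrix (Fin n) (Fin n) ℂ) : Matrix (Fin n) (Fin n) ℂ := e₁ * X * (1 - e₁)

/-- A unipotent matrix that depends on the first row and the first column of `X`. -/
def conjMatrix (X : Matrix (Fin n) (Fin n) ℂ) : Matrix (Fin n) (Fin n) ℂ :=
  (1 + colPart X) * (1 + rowPart X)

/-- The inverse of `conjMatrix X`. -/
def conjMatrixInv (X : Matrix (Fin n) (Fin n) ℂ) : Matrix (Fin n) (Fin n) ℂ :=
  (1 - rowPart X) * (1 - colPart X)

variable (X Y : Matrix (Fin n) (Fin n) ℂ)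

lemma diag_mul_colPart : e₁ * colPart X = 0 := by
  rw [colPart, ← mul_assoc, ← mul_assoc, mul_sub, mul_one, diagonal_firstInd_mul_self, sub_self,
    zero_mul, zero_mul]

lemma colPart_mul_diag : colPart X * e₁ = colPart X := by
  rw [colPart, mul_assoc, diagonal_firstInd_mul_self]

lemma diag_mul_rowPart : e₁ * rowPart X = rowPart X := by
  rw [rowPart, ← mul_assoc, ← mul_assoc, diagonal_firstInd_mul_self]

lemma rowPart_mul_diag : rowPart X * e₁ = 0 := by
  rw [rowPart, mul_assoc, sub_mul, one_mul, diagonal_firstInd_mul_self, sub_self, mul_zero]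

lemma colPart_mul_colPart : colPart X * colPart Y = 0 := by
  rw [← colPart_mul_diag X, mul_assoc, diag_mul_colPart, mul_zero]

lemma rowPart_mul_rowPart : rowPart X * rowPart Y = 0 := by
  rw [← diag_mul_rowPart Y, ← mul_assoc, rowPart_mul_diag, zero_mul]

lemma conjMatrix_mul_inv : conjMatrix X * conjMatrixInv X = 1 := by
  calc conjMatrix X * conjMatrixInv X
      = (1 + colPart X) * (1 - rowPart X * rowPart X) * (1 - colPart X) := by
        rw [conjMatrix, conjMatrixInv]; noncomm_ring
    _ = 1 - colPart X * colPart X := by rw [rowPart_mul_rowPart]; noncomm_ring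
    _ = 1 := by rw [colPart_mul_colPart, sub_zero]

lemma conjMatrixInv_mul : conjMatrixInv X * conjMatrix X = 1 := by
  calc conjMatrixInv X * conjMatrix X
      = (1 - rowPart X) * (1 - colPart X * colPart X) * (1 + rowPart X) := by
        rw [conjMatrix, conjMatrixInv]; noncomm_ring
    _ = 1 - rowPart X * rowPart X := by rw [colPart_mul_colPart]; noncomm_ring
    _ = 1 := by rw [rowPart_mul_rowPart, sub_zero]

/-- The linear part -R + C, with R = `rowPart X` and C = `colPart X`, shows all 2(n - 1) directions
of the orbit. -/
lemma conjMatrix_diag_inv : conjMatrix X * e₁ * conjMatrixInv X =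
    e₁ - rowPart X + colPart X - colPart X * rowPart X + rowPart X * colPart X +
      colPart X * rowPart X * colPart X := by
  have h1 : conjMatrix X * e₁ = e₁ + colPart X := by
    rw [conjMatrix, mul_assoc, add_mul 1 (rowPart X), rowPart_mul_diag, one_mul, add_zero, add_mul,
      colPart_mul_diag, one_mul]
  have h2 : (e₁ + colPart X) * (1 - rowPart X) =
      e₁ + colPart X - rowPart X - colPart X * rowPart X := by
    rw [mul_sub, add_mul _ _ (rowPart X), diag_mul_rowPart]
    noncomm_ring
  rw [h1, conjMatrixInv, ← mul_assoc, h2, mul_sub]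
  simp only [sub_mul, add_mul, diag_mul_colPart, colPart_mul_colPart]
  noncomm_ring

variable {E : Type*} [NormedAddCommGroup E] [NormedSpace ℂ E]
variable {Z : E → Matrix (Fin n) (Fin n) ℂ} {D : Matrix (Fin n) (Fin n) ℂ} {w ξ : E}

lemma HasMatDeriv.colPart (h : HasMatDeriv Z D w ξ) :
    HasMatDeriv (fun w => colPart (Z w)) (colPart D) w ξ := h.conj _ _

lemma HasMatDeriv.rowPart (h : HasMatDeriv Z D w ξ) :
    HasMatDeriv (fun w => rowPart (Z w)) (rowPart D) w ξ := h.conj _ _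

lemma HasMatDeriv.sub {A B : E → Matrix (Fin n) (Fin n) ℂ} {DA DB : Matrix (Fin n) (Fin n) ℂ}
    (h : HasMatDeriv A DA w ξ) (h' : HasMatDeriv B DB w ξ) :
    HasMatDeriv (fun w => A w - B w) (DA - DB) w ξ := by
  simpa [sub_eq_add_neg] using h.add (h'.const_smul (-1))

lemma HasMatDeriv.conjMatrix (h : HasMatDeriv Z D w ξ) :
    HasMatDeriv (fun w => conjMatrix (Z w))
      (MatrixP4.colPart D * (1 + MatrixP4.rowPart (Z w)) +
        (1 + MatrixP4.colPart (Z w)) * MatrixP4.rowPart D) w ξ := by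
  simpa [MatrixP4.conjMatrix] using ((hasMatDeriv_const 1 w ξ).add h.colPart).mul
    ((hasMatDeriv_const 1 w ξ).add h.rowPart)

lemma HasMatDeriv.conjMatrixInv (h : HasMatDeriv Z D w ξ) :
    HasMatDeriv (fun w => conjMatrixInv (Z w))
      (-MatrixP4.rowPart D * (1 - MatrixP4.colPart (Z w)) +
        (1 - MatrixP4.rowPart (Z w)) * -MatrixP4.colPart D) w ξ := by
  simpa [MatrixP4.conjMatrixInv] using ((hasMatDeriv_const 1 w ξ).sub h.rowPart).mul
    ((hasMatDeriv_const 1 w ξ).sub h.colPart)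

/-- The parameters in the first row and the first column can be read off from the conjugate of
`diag(1, 0, …, 0)`. -/
lemma parts_eq_zero_of_residue (h : HasMatDeriv Z D w ξ)
    (h0 : HasMatDeriv (fun w => conjMatrix (Z w) * e₁ * conjMatrixInv (Z w)) 0 w ξ) :
    colPart D = 0 ∧ rowPart D = 0 := by
  simp only [conjMatrix_diag_inv] at h0
  have hC := h.colPart
  have hR := h.rowPart
  have key := h0.unique ((((((hasMatDeriv_const e₁ w ξ).sub hR).add hC).sub (hC.mul hR)).add
    (hR.mul hC)).add ((hC.mul hR).mul hC))
  have eC := diag_mul_colPart (Z w)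
  have eD := diag_mul_colPart D
  have Ce := colPart_mul_diag (Z w)
  have De := colPart_mul_diag D
  have eR := diag_mul_rowPart (Z w)
  have er := diag_mul_rowPart D
  have Re := rowPart_mul_diag (Z w)
  have re := rowPart_mul_diag D
  generalize colPart (Z w) = C at *
  generalize rowPart (Z w) = R at *
  generalize colPart D = c at *
  generalize rowPart D = r at *
  have hr : r = 0 := by
    -- Compression to the first row outside the corner leaves only -r. With r = 0 the other
    -- compressions give R c = 0 and c R = 0, and what remains of the identity is c = 0.
    have h1 := congrArg (fun M => e₁ * M * (1 - e₁)) key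
    simp only [mul_add, mul_sub, add_mul, sub_mul, mul_one, mul_assoc, Ce, De, Re, re] at h1
    simp only [← mul_assoc, eC, eD, eR, er] at h1
    simpa using h1
  subst hr
  have hRc : R * c = 0 := by
    have h1 := congrArg (fun M => e₁ * M) key
    simp only [mul_add, mul_sub, ← mul_assoc, eC, eD, eR, er] at h1
    simpa using h1.symm
  have hcR : c * R = 0 := by
    have h1 := congrArg (fun M => M * (1 - e₁)) key
    simp only [add_mul, sub_mul, mul_sub, mul_one, mul_assoc, Ce, De, Re, hRc] at h1
    simpa using h1
  refine ⟨?_, rfl⟩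
  simpa [mul_assoc, hRc, hcR, ← mul_assoc c R] using key.symm

end Conjugation

/-! ### Sufficiency: the family with 2n² parameters -/

section Family

variable {n : ℕ} {E : Type*} [NormedAddCommGroup E] [NormedSpace ℂ E]

lemma differentiableAt_regularCoeff (α β : ℂ) {X Y : E → Matrix (Fin n) (Fin n) ℂ} {w : E}
    (hX : ∀ i j, DifferentiableAt ℂ (fun w => X w i j) w)
    (hY : ∀ i j, DifferentiableAt ℂ (fun w => Y w i j) w) (k : ℕ) :
    (∀ i j, DifferentiableAt ℂ (fun w => (regularCoeff α β (X w) (Y w) k).1 i j) w) ∧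
      ∀ i j, DifferentiableAt ℂ (fun w => (regularCoeff α β (X w) (Y w) k).2 i j) w := by
  induction k using Nat.strong_induction_on with
  | _ k ih =>
    have hx := fun i hi => hasMatDeriv_of_differentiableAt (ih i hi).1 0
    have hy := fun i hi => hasMatDeriv_of_differentiableAt (ih i hi).2 0
    have hU : ∀ i j, DifferentiableAt ℂ (fun w => forcingU α β (X w) (Y w) k i j) w :=
      fun i j => (HasMatDeriv.sum (Finset.range k) (fun l hl => HasMatDeriv.quadForm α
        (hx l (Finset.mem_range.1 hl)) (hy l (Finset.mem_range.1 hl))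
        (hx (k - 1 - l) (by have := Finset.mem_range.1 hl; omega))
        (hy (k - 1 - l) (by have := Finset.mem_range.1 hl; omega))) i j).1
    have hV : ∀ i j, DifferentiableAt ℂ (fun w => forcingV α β (X w) (Y w) k i j) w :=
      fun i j => (HasMatDeriv.sum (Finset.range k) (fun l hl => HasMatDeriv.quadForm β
        (hy l (Finset.mem_range.1 hl)) (hx l (Finset.mem_range.1 hl))
        (hy (k - 1 - l) (by have := Finset.mem_range.1 hl; omega))
        (hx (k - 1 - l) (by have := Finset.mem_range.1 hl; omega))) i j).1
    have hy' : ∀ i j, DifferentiableAt ℂ (fun w => (regularCoeff α β (X w) (Y w) k).2 i j) w := by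
      intro i j
      simp only [regularCoeff_snd_apply, div_eq_mul_inv]
      refine ((hV i j).mul_const _).add ?_
      split_ifs
      · exact hY i j
      · exact differentiableAt_const _
    refine ⟨fun i j => ?_, hy'⟩
    simp only [regularCoeff_fst_apply, div_eq_mul_inv]
    refine (((hU i j).add ((hy' i j).const_mul _)).mul_const _).add ?_
    split_ifs
    · exact hX i j
    · exact differentiableAt_const _

lemma hasMatDeriv_linear [FiniteDimensional ℂ E] (L : E →ₗ[ℂ] Matrix (Fin n) (Fin n) ℂ)
    (w ξ : E) : HasMatDeriv (fun w => L w) (L ξ) w ξ := fun i j => by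
  have h := (LinearMap.toContinuousLinearMap
    (Matrix.entryLinearMap ℂ ℂ i j ∘ₗ L)).hasFDerivAt (x := w)
  exact ⟨h.differentiableAt, by
    have := h.fderiv
    exact congrArg (fun f => f ξ) this⟩

/-- X has three roles: its corner is z₀, the rest of its first row and column moves the residue, and
the remaining block is free in x₀. Each entry of Y is free at its own resonance. -/
lemma existsMaximalType2_of_compatibility (hn : 0 < n) {α β : ℂ}
    (hres : ∀ i j : Fin n, ∃ k : ℕ, resonance β i j = k)
    (hcompat : ∀ (X Y : Matrix (Fin n) (Fin n) ℂ) (k : ℕ) i j,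
      resonance β i j = k → forcingV α β X Y k i j = 0) :
    ExistsMaximalType2 n α β := by
  let Φ : (Fin (2 * n ^ 2) → ℂ) ≃ₗ[ℂ] Matrix (Fin n) (Fin n) ℂ × Matrix (Fin n) (Fin n) ℂ :=
    LinearEquiv.ofFinrankEq _ _ (by
      rw [Module.finrank_prod, Module.finrank_matrix, Module.finrank_fin_fun, Module.finrank_self]
      simp
      ring)
  let X : (Fin (2 * n ^ 2) → ℂ) →ₗ[ℂ] Matrix (Fin n) (Fin n) ℂ := LinearMap.fst ℂ _ _ ∘ₗ Φ.toLinearMap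
  let Y : (Fin (2 * n ^ 2) → ℂ) →ₗ[ℂ] Matrix (Fin n) (Fin n) ℂ := LinearMap.snd ℂ _ _ ∘ₗ Φ.toLinearMap
  let A : ℕ → (Fin (2 * n ^ 2) → ℂ) → Matrix (Fin n) (Fin n) ℂ := fun m w =>
    withResidue (Matrix.diagonal firstInd) (fun k => (regularCoeff α β (X w) (Y w) k).1) m
  let B : ℕ → (Fin (2 * n ^ 2) → ℂ) → Matrix (Fin n) (Fin n) ℂ := fun m w =>
    withResidue 0 (fun k => (regularCoeff α β (X w) (Y w) k).2) m
  have hX : ∀ w ξ, HasMatDeriv (fun w => X w) (X ξ) w ξ := hasMatDeriv_linear X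
  have hY : ∀ w ξ, HasMatDeriv (fun w => Y w) (Y ξ) w ξ := hasMatDeriv_linear Y
  have hreg := fun w => differentiableAt_regularCoeff α β (fun i j => (hX w 0 i j).1)
    (fun i j => (hY w 0 i j).1)
  have hA : ∀ m w i j, DifferentiableAt ℂ (fun w => A m w i j) w := fun m w i j => by
    rcases m with _ | k
    · exact differentiableAt_const _
    · exact (hreg w k).1 i j
  have hB : ∀ m w i j, DifferentiableAt ℂ (fun w => B m w i j) w := fun m w i j => by
    rcases m with _ | k
    · exact differentiableAt_const _
    · exact (hreg w k).2 i j
  have hdiff : ∀ (F : ℕ → (Fin (2 * n ^ 2) → ℂ) → Matrix (Fin n) (Fin n) ℂ),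
      (∀ m w i j, DifferentiableAt ℂ (fun w => F m w i j) w) → ∀ (k : ℤ) (i j : Fin n) w,
      DifferentiableAt ℂ (fun w => (laurentOfSeq fun m =>
        conjMatrix (X w) * F m w * conjMatrixInv (X w)).coeff k i j) w := by
    intro F hF k i j w
    simp only [laurentOfSeq_coeff]
    split_ifs
    · exact differentiableAt_const _
    · exact (((hX w 0).conjMatrix.mul (hasMatDeriv_of_differentiableAt (hF _ w) 0)).mul
        (hX w 0).conjMatrixInv i j).1
  refine ⟨Set.univ, fun w => X w ⟨0, hn⟩ ⟨0, hn⟩,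
    fun w => laurentOfSeq fun m => conjMatrix (X w) * A m w * conjMatrixInv (X w),
    fun w => laurentOfSeq fun m => conjMatrix (X w) * B m w * conjMatrixInv (X w),
    ⟨isOpen_univ, Set.univ_nonempty, fun w _ => ?_, fun w _ => ?_, fun k i j w _ => ?_,
      fun k i j w _ => ?_, ?_⟩, fun w _ => ⟨by omega, ⟨conjMatrix (X w), conjMatrixInv (X w),
        conjMatrix_mul_inv _, conjMatrixInv_mul _⟩, ?_, ?_⟩⟩
  · exact ((isSeqSolution_withResidue α β (X w) (Y w) (hcompat (X w) (Y w))).conj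
      (conjMatrixInv_mul (X w))).isFormalSolution
  · exact (hX w 0 _ _).1.differentiableWithinAt
  · exact (hdiff A hA k i j w).differentiableWithinAt
  · exact (hdiff B hB k i j w).differentiableWithinAt
  · intro w _ ξ hz hu hv
    have hu' : ∀ m, HasMatDeriv (fun w => conjMatrix (X w) * A m w * conjMatrixInv (X w)) 0 w ξ :=
      fun m i j => by
        have h1 := hdiff A hA ((m : ℤ) - 1) i j w
        have h2 := hu ((m : ℤ) - 1) i j
        simp only [laurentOfSeq_coeff_nat] at h1 h2
        exact ⟨h1, h2⟩
    have hv' : ∀ m, HasMatDeriv (fun w => conjMatrix (X w) * B m w * conjMatrixInv (X w)) 0 w ξ :=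
      fun m i j => by
        have h1 := hdiff B hB ((m : ℤ) - 1) i j w
        have h2 := hv ((m : ℤ) - 1) i j
        simp only [laurentOfSeq_coeff_nat] at h1 h2
        exact ⟨h1, h2⟩
    -- The residue alone shows that the conjugating matrix is stationary along ξ, so the conjugation
    -- can be undone in all other coefficients.
    obtain ⟨hcol, hrow⟩ := parts_eq_zero_of_residue (hX w ξ) (hu' 0)
    have hS := (hX w ξ).conjMatrix
    have hT := (hX w ξ).conjMatrixInv
    simp only [hcol, hrow, zero_mul, mul_zero, neg_zero, add_zero] at hS hT
    have hcancel : ∀ (F : (Fin (2 * n ^ 2) → ℂ) → Matrix (Fin n) (Fin n) ℂ),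
        HasMatDeriv (fun w => conjMatrix (X w) * F w * conjMatrixInv (X w)) 0 w ξ →
          HasMatDeriv F 0 w ξ := by
      intro F hF
      have := (hT.mul hF).mul hS
      simp only [zero_mul, mul_zero, add_zero] at this
      convert this using 2 with w
      calc F w = 1 * F w * 1 := by noncomm_ring
        _ = (conjMatrixInv (X w) * conjMatrix (X w)) * F w *
              (conjMatrixInv (X w) * conjMatrix (X w)) := by rw [conjMatrixInv_mul]
        _ = _ := by noncomm_ring
    have hXξ : X ξ = 0 := by
      ext i j
      rw [Matrix.zero_apply]
      rcases firstInd_eq i with hi | hi <;> rcases firstInd_eq j with hj | hj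
      · have h1 := (hcancel (A 1) (hu' 1) i j).2
        -- The denominator is 0 at this entry, so the quotient is 0 and only the free entry of X
        -- remains; likewise for Y below.
        have h2 : ∀ w, A 1 w i j = X w i j := fun w => by
          have := regularCoeff_fst_apply α β (X w) (Y w) 0 i j
          rw [hi, hj] at this
          exact this.trans (by simp)
        simp only [h2] at h1
        rw [← (hX w ξ i j).2, h1, Matrix.zero_apply]
      · have := congrFun (congrFun hcol i) j
        simpa [colPart, sub_mul, Matrix.mul_diagonal, Matrix.diagonal_mul, hi, hj] using this
      · have := congrFun (congrFun hrow i) j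
        simpa [rowPart, mul_sub, Matrix.mul_diagonal, Matrix.diagonal_mul, hi, hj] using this
      · have h0 : firstInd (⟨0, hn⟩ : Fin n) ≠ 0 := by simp [firstInd]
        obtain rfl := eq_of_firstInd (i := i) (by simp [hi]) h0
        obtain rfl := eq_of_firstInd (i := j) (by simp [hj]) h0
        rw [← (hX w ξ _ _).2, hz]
    have hYξ : Y ξ = 0 := by
      ext i j
      obtain ⟨k, hk⟩ := hres i j
      have h1 := (hcancel (B (k + 1)) (hv' (k + 1)) i j).2
      have h2 : ∀ w, B (k + 1) w i j = Y w i j := fun w => by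
        have := regularCoeff_snd_apply α β (X w) (Y w) k i j
        rw [hk] at this
        exact this.trans (by simp)
      simp only [h2] at h1
      rw [← (hY w ξ i j).2, h1]
    exact Φ.map_eq_zero_iff.1 (Prod.ext hXξ hYξ)
  · rw [resP_zero_one_eq]
    exact laurentOfSeq_coeff_nat _ 0
  · rw [resQ_zero_one_zero]
    refine (laurentOfSeq_coeff_nat _ 0).trans ?_
    simp [B, withResidue]

lemma existsMaximalType2_of_int (hn : 0 < n) {α β : ℂ}
    (h : ∃ m : ℤ, β = (m : ℂ) ∧ -2 ≤ m ∧ m ≤ 0) : ExistsMaximalType2 n α β := by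
  obtain ⟨m, rfl, h1, h2⟩ := h
  refine existsMaximalType2_of_compatibility hn (fun i j => ?_) (fun X Y k i j h => ?_)
  · obtain rfl | rfl | rfl : m = -2 ∨ m = -1 ∨ m = 0 := by omega
    all_goals
      rcases firstInd_eq i with hi | hi <;> rcases firstInd_eq j with hj | hj <;>
        simp only [resonance, hi, hj] <;>
        first
          | exact ⟨0, by push_cast; ring1⟩
          | exact ⟨1, by push_cast; ring1⟩
          | exact ⟨2, by push_cast; ring1⟩
  · obtain rfl | rfl | rfl : m = -2 ∨ m = -1 ∨ m = 0 := by omega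
    · push_cast at h ⊢
      exact compatibility_neg_two h
    · push_cast at h ⊢
      exact compatibility_neg_one h
    · push_cast at h ⊢
      exact compatibility_zero h

end Family

end MatrixP4

end

theorem mainTheorem3 (n : ℕ) (hn : 2 ≤ n) (α β : ℂ) :
    (MatrixP4.ExistsMaximalType1 n α β ↔
      ∃ m : ℤ, α + β = (m : ℂ) ∧ -3 ≤ m ∧ m ≤ -1) ∧
    (MatrixP4.ExistsMaximalType2 n α β ↔
      ∃ m : ℤ, β = (m : ℂ) ∧ -2 ≤ m ∧ m ≤ 0) ∧
    (MatrixP4.ExistsMaximalType3 n α β ↔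
      ∃ m : ℤ, α = (m : ℂ) ∧ -2 ≤ m ∧ m ≤ 0) := by
  have key : ∀ α β : ℂ, MatrixP4.ExistsMaximalType2 n α β ↔
      ∃ m : ℤ, β = (m : ℂ) ∧ -2 ≤ m ∧ m ≤ 0 := fun α β =>
    ⟨MatrixP4.exists_int_of_existsMaximalType2 hn,
      MatrixP4.existsMaximalType2_of_int (by omega)⟩
  refine ⟨?_, key α β, (MatrixP4.existsMaximalType3_iff_type2 α β).trans (key β α)⟩
  -- Type 1 becomes type 2 with -3 - α - β in the place of β, so m ↦ -3 - m exchanges the two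
  -- ranges.
  rw [MatrixP4.existsMaximalType1_iff_type3, MatrixP4.existsMaximalType3_iff_type2, key]
  constructor
  · rintro ⟨m, h, h1, h2⟩
    exact ⟨-3 - m, by push_cast; linear_combination -h, by omega, by omega⟩
  · rintro ⟨m, h, h1, h2⟩
    exact ⟨-3 - m, by push_cast; linear_combination -h, by omega, by omega⟩
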